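/- Let $K$ be a commutative ring, $x\in K$ invertible, $q=x^2$, and $\gamma,\delta\in K$. For $n\ge 1$ let $b_n^K$ be the unital $K$-algebra with generators $e,U_1,\dots,U_{n-1}$ and relations $$U_iU_i=(q+q^{-1})U_i,\quad U_iU_{i\pm1}U_i=U_i,\quad U_iU_j=U_jU_i\ (|i-j|\ne 1),$$ $$U_1eU_1=\gamma U_1,\quad ee=\delta e,\quad U_ie=eU_i\ (i\neq 1),$$ and let $b_0^K=K$. Let $k$ be a commutative $K$-algebra (for instance a field) and $b_n=k\otimes_K b_n^K$. Let $a\mapsto a^o$ be the anti-automorphism of $b_n$ that fixes the generators. For $0\le m\le n$, $m\equiv n \pmod 2$, put $E_m=E_m^{(n)}=U_1U_3\cdots U_{n-m-1}$ (with $E_n=1$). For $0<m\le n$, $m\equiv n\pmod 2$, put $E_{m+}=E_m\,e\,U_2U_4\cdots U_{n-m}\,E_m$; for $m\le 0$ read $E_{m+}$ as $E_{-m}$. A walk of length $n$ to weight $m$ is a sequence of integers $0=\sigma_0,\sigma_1,\dots,\sigma_n=m$ with $|\sigma_{i+1}-\sigma_i|=1$. To its step from $\sigma_i$ to $\sigma_{i+1}$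 associate the word $U_iU_{i-1}\cdots U_1$ if $|\sigma_{i+1}|<|\sigma_i|$; the word $e\,(U_iU_{i-2}\cdots U_2)(U_{i-1}U_{i-3}\cdots U_1)$ if $\sigma_i=0$, $\sigma_{i+1}=1$ (which is $e$ if $i=0$); and $1$ otherwise. The word $w(p)$ of a walk $p$ is the product, from left to right, of the words of its steps, and $S_{(n,m)}\subset b_n$ is the set of all $w(p)$, $p$ a walk of length $n$ to weight $m$. For every $m$ there is a set $s(n,m)$ of words in the generators of $b_n$ such that $S_{(n,m)}=\{wE_{m+} : w\in s(n,m)\}$. For any choice of these sets let $S^2_{(n,m)}=\{aE_{m+}b^o : a,b\in s(n,m)\}$. Then: (1) For every $m$, $S^2_{(n,m)}$ spans over $k$ the double-sided ideal of $b_n$ that it generates, modulo the sum $J$ of the double-sided ideals generated by the sets $S^2_{(n,m')}$ with $|m'|<|m|$ and, if $m<0$, also $m'=-m$; that is, $b_nS^2_{(n,m)}b_n+J=\operatorname{span}_k S^2_{(n,m)}+J$, where $b_nS^2_{(n,m)}b_n$ denotes the double-sided ideal generated by $S^2_{(n,m)}$. (2) $S^2_{(n)}:=\bigcup_m S^2_{(n,m)}$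 spans $b_n$ over $k$. -/

import Mathlib

open scoped TensorProduct

noncomputable section

namespace Blob

/-! ### Words

Letters are natural numbers: the letter `0` is `e` (also written `U_0`), and the letter `i ≥ 1` is
`U_i`.  The alphabet of the algebra `b_n` is `{i | i < n}`: it is empty for `n = 0`, it is `{e}` for
`n = 1`, and it is `{e, U_1, …, U_{n-1}}` in general. -/

/-- Words in the letters `e = U_0, U_1, U_2, …`. -/
abbrev Word := List ℕ

/-- `U_{i \ j} = U_i U_{i-1} ⋯ U_j` if `i ≥ j`, and the empty word otherwise. -/
def chain (i j : ℕ) : Word := (List.range (i + 1 - j)).map fun t => i - t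

/-- `U_{i \\ j} = U_i U_{i-2} ⋯ U_j` if `i - j` is a nonnegative even number, and the empty word
otherwise. -/
def chainTwo (i j : ℕ) : Word :=
  if j ≤ i ∧ Even (i - j) then (List.range ((i - j) / 2 + 1)).map fun t => i - 2 * t else []

/-- `E_m^{(n)} = U_1 U_3 ⋯ U_{n-m-1}` for `0 ≤ m ≤ n`, `m ≡ n` mod 2 (the empty word if `m = n`). -/
def wordE (n m : ℕ) : Word := (List.range ((n - m) / 2)).map fun t => 2 * t + 1

/-- For `m > 0`: `E_{m+}^{(n)} = E_m^{(n)} e U_2 U_4 ⋯ U_{n-m} E_m^{(n)}`.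
For `m ≤ 0`, where `m+` means `-m`: `E_{-m}^{(n)}`. -/
def wordEplus (n : ℕ) (m : ℤ) : Word :=
  if 0 < m then
    wordE n m.natAbs ++ [0] ++ ((List.range ((n - m.natAbs) / 2)).map fun t => 2 * t + 2) ++
      wordE n m.natAbs
  else wordE n m.natAbs

/-! ### Walks on the Pascal triangle and their words -/

/-- `Walk n m` is the set `S_{n,m}` of walks on the Pascal triangle from the vertex of level `0` and
weight `0` to the vertex of level `n` and weight `m`. -/
inductive Walk : ℕ → ℤ → Type
  | start : Walk 0 0
  | step {n : ℕ} {m : ℤ} (p : Walk n m) (m' : ℤ) (h : m' = m + 1 ∨ m' = m - 1) : Walk (n + 1) m'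

/-- The word of the edge from `(n, m)` to `(n + 1, m')`:
`e U_{n \\ 2} U_{n-1 \\ 1}` if `(m, m') = (0, 1)`; `1` on the other edges that lead away from weight
`0`; and `U_n U_{n-1} ⋯ U_1` on the edges that lead towards weight `0`. -/
def edgeWord (n : ℕ) (m m' : ℤ) : Word :=
  if m = 0 then
    if m' = 1 then 0 :: (chainTwo n 2 ++ chainTwo (n - 1) 1) else []
  else if m'.natAbs < m.natAbs then chain n 1 else []

/-- The word `w(p)` of a walk: the product, from left to right, of the words of its edges. -/
def Walk.word : {n : ℕ} → {m : ℤ} → Walk n m → Word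
  | _, _, .start => []
  | _, _, .step (n := n) (m := m) p m' _ => p.word ++ edgeWord n m m'

/-! ### The blob algebra -/

section Algebra

variable (K : Type*) [CommRing K] (x : Kˣ) (γ δ : K) (n : ℕ)

/-- The defining relations of `b_n^K`, with `q = x²`; the generator with index `0` is `e`. -/
inductive Rel : FreeAlgebra K (Fin n) → FreeAlgebra K (Fin n) → Prop
  | U_sq (i : Fin n) (hi : 1 ≤ i.val) :
      Rel (FreeAlgebra.ι K i * FreeAlgebra.ι K i)
        ((((x ^ 2 : Kˣ) : K) + (((x ^ 2)⁻¹ : Kˣ) : K)) • FreeAlgebra.ι K i)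
  | U_adjacent (i j : Fin n) (hi : 1 ≤ i.val) (hj : 1 ≤ j.val)
      (hij : j.val = i.val + 1 ∨ i.val = j.val + 1) :
      Rel (FreeAlgebra.ι K i * FreeAlgebra.ι K j * FreeAlgebra.ι K i) (FreeAlgebra.ι K i)
  | U_comm (i j : Fin n) (hi : 1 ≤ i.val) (hj : 1 ≤ j.val)
      (hij : ¬ (j.val = i.val + 1 ∨ i.val = j.val + 1)) :
      Rel (FreeAlgebra.ι K i * FreeAlgebra.ι K j) (FreeAlgebra.ι K j * FreeAlgebra.ι K i)
  | U_e_U (u e : Fin n) (hu : u.val = 1) (he : e.val = 0) :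
      Rel (FreeAlgebra.ι K u * FreeAlgebra.ι K e * FreeAlgebra.ι K u) (γ • FreeAlgebra.ι K u)
  | e_sq (e : Fin n) (he : e.val = 0) :
      Rel (FreeAlgebra.ι K e * FreeAlgebra.ι K e) (δ • FreeAlgebra.ι K e)
  | e_comm (i e : Fin n) (hi : 2 ≤ i.val) (he : e.val = 0) :
      Rel (FreeAlgebra.ι K i * FreeAlgebra.ι K e) (FreeAlgebra.ι K e * FreeAlgebra.ι K i)

/-- The algebra `b_n^K`, given by generators and relations. -/
abbrev AlgK : Type _ := RingQuot (Rel K x γ δ n)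

/-- The generators of `b_n^K`: `e` for `i = 0`, and `U_i` for `1 ≤ i < n`. -/
def genK (i : Fin n) : AlgK K x γ δ n :=
  RingQuot.mkAlgHom K (Rel K x γ δ n) (FreeAlgebra.ι K i)

/-- The homomorphism from `b_n^K` to its opposite algebra that fixes the generators. -/
def oppK : AlgK K x γ δ n →ₐ[K] (AlgK K x γ δ n)ᵐᵒᵖ :=
  RingQuot.liftAlgHom K
    ⟨FreeAlgebra.lift K fun i => MulOpposite.op (genK K x γ δ n i), by
      intro a b h
      have key := fun {a b} (h : Rel K x γ δ n a b) => RingQuot.mkAlgHom_rel K h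
      cases h with
      | U_sq i hi =>
        have := key (.U_sq i hi)
        simp only [map_mul, map_smul, FreeAlgebra.lift_ι_apply] at this ⊢
        exact congrArg MulOpposite.op this
      | U_adjacent i j hi hj hij =>
        have := key (.U_adjacent i j hi hj hij)
        simp only [map_mul, FreeAlgebra.lift_ι_apply, mul_assoc] at this ⊢
        rw [← mul_assoc] at this
        exact congrArg MulOpposite.op this
      | U_comm i j hi hj hij =>
        have := key (.U_comm i j hi hj hij)
        simp only [map_mul, FreeAlgebra.lift_ι_apply] at this ⊢
        exact congrArg MulOpposite.op this.symm
      | U_e_U u e hu he =>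
        have := key (.U_e_U u e hu he)
        simp only [map_mul, map_smul, FreeAlgebra.lift_ι_apply, mul_assoc] at this ⊢
        rw [← mul_assoc] at this
        exact congrArg MulOpposite.op this
      | e_sq e he =>
        have := key (.e_sq e he)
        simp only [map_mul, map_smul, FreeAlgebra.lift_ι_apply] at this ⊢
        exact congrArg MulOpposite.op this
      | e_comm i e hi he =>
        have := key (.e_comm i e hi he)
        simp only [map_mul, FreeAlgebra.lift_ι_apply] at this ⊢
        exact congrArg MulOpposite.op this.symm⟩

theorem oppK_genK (i : Fin n) :
    oppK K x γ δ n (genK K x γ δ n i) = MulOpposite.op (genK K x γ δ n i) := by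
  simp [oppK, genK]

variable (k : Type*) [CommRing k] [Algebra K k]

/-- The `k`-algebra `b_n = k ⊗_K b_n^K`. -/
abbrev Alg : Type _ := k ⊗[K] AlgK K x γ δ n

/-- The element of `b_n` named by a letter: `e` for `0`, and `U_i` for `1 ≤ i < n`.  Letters `i ≥ n`
do not belong to the alphabet of `b_n`; they get the value `0`, which is never used. -/
def gen (i : ℕ) : Alg K x γ δ n k :=
  if h : i < n then 1 ⊗ₜ[K] genK K x γ δ n ⟨i, h⟩ else 0

/-- The element of `b_n` named by a word. -/
def eval (w : Word) : Alg K x γ δ n k := (w.map (gen K x γ δ n k)).prod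

/-- The homomorphism from `b_n` to its opposite algebra that fixes the generators. -/
def opp : Alg K x γ δ n k →ₐ[k] (Alg K x γ δ n k)ᵐᵒᵖ :=
  Algebra.TensorProduct.lift (Algebra.ofId k _)
    ((AlgHom.op (Algebra.TensorProduct.includeRight :
      AlgK K x γ δ n →ₐ[K] Alg K x γ δ n k)).comp (oppK K x γ δ n))
    fun c _ => Algebra.commutes c _

theorem opp_gen (i : ℕ) :
    opp K x γ δ n k (gen K x γ δ n k i) = MulOpposite.op (gen K x γ δ n k i) := by
  unfold gen
  split
  · refine (Algebra.TensorProduct.lift_tmul _ _ _ _ _).trans ?_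
    rw [map_one, one_mul]
    simp [oppK_genK]
  · simp

/-- The image `a^o` of `a` under the opposite isomorphism. -/
def opposite (a : Alg K x γ δ n k) : Alg K x γ δ n k := MulOpposite.unop (opp K x γ δ n k a)

/-- The set `S_{(n,m)} ⊆ b_n` of the (elements named by the) words `w(p)`, where `p` is a walk from
`(0, 0)` to `(n, m)`. -/
def setS (m : ℤ) : Set (Alg K x γ δ n k) :=
  Set.range fun p : Walk n m => eval K x γ δ n k p.word

/-- `s` is a possible choice of the set `s(n,m)`: a set of words in the generators of `b_n` with
`S_{(n,m)} = {w E_{m+} | w ∈ s}`. -/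
def IsCoefficientSet (m : ℤ) (s : Set Word) : Prop :=
  (∀ w ∈ s, ∀ i ∈ w, i < n) ∧
    setS K x γ δ n k m =
      {y | ∃ w ∈ s, y = eval K x γ δ n k w * eval K x γ δ n k (wordEplus n m)}

/-- The set `S²_{(n,m)} = {a E_{m+} b^o | a, b ∈ s}`, formed with `s = s(n,m)`. -/
def setSsq (m : ℤ) (s : Set Word) : Set (Alg K x γ δ n k) :=
  {y | ∃ a ∈ s, ∃ b ∈ s, y = eval K x γ δ n k a * eval K x γ δ n k (wordEplus n m) *
    opposite K x γ δ n k (eval K x γ δ n k b)}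

end Algebra

/-- The two-sided ideal generated by a subset of a `k`-algebra, as a `k`-submodule. -/
def idealSpan (k : Type*) {B : Type*} [CommRing k] [Ring B] [Algebra k B] (S : Set B) :
    Submodule k B :=
  (TwoSidedIdeal.span S).asIdeal.restrictScalars k

end Blob

end

open scoped TensorProduct

noncomputable section

/-! A walk element is half of a diagram: its right end is a row of cups `odds U k`, where `k` counts
the steps toward 0, and |m| lines stay open. Everything rests on the left action (`U_mul_walk`): a
generator times a walk element of weight m is a scalar times a walk element of weight m, or of
weight -m if m < 0, or it is a walk element of smaller absolute weight times some factor on the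
right.

The letter e acts on the first step only (`e_mul_elt`). For U_i and weight at most 0 (`U_mul_elt`),
U_i commutes past all but steps i and i+1 of the walk of length i+1. Those two steps give a scalar,
a new walk, or a cap joining two open lines; later steps toward 0 move the cap by two places
(`U_mul_desc`) or straighten it. Positive weights reduce to negative ones: reflecting a walk after
its last visit to 0 is right multiplication by `decor U k` (`exists_reflect`), since decorations
slide through the chains (`desc_one_mul_decor`).

Moreover E_{m+} is a walk element and is fixed by the reversal, so every walk element and its
reverse lie in S² (`elt_mem_sqSet`, `map_elt_mem_sqSet`). The error terms of the left action thus
fall into the preceding ideals, and reversal gives the right action; this is (1). For (2), order the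
weights as 0, 1, -1, 2, -2, …; inductively each ideal lies in the span of S². The ideal of weight -n
contains 1, because its E is the empty word. -/

namespace Blob

/-! ### Identities among chains, cups and decorations -/

section Relations

variable {R A : Type*} [CommRing R] [Ring A] [Algebra R A]

/-- The defining relations of the blob algebra on `n` strings, for a family of elements indexed by
the letters; letters outside the alphabet are expected to have the value `0`. -/
structure IsBlobFamily (U : ℕ → A) (n : ℕ) (κ γ δ : R) : Prop where
  sq : ∀ i, U (i + 1) * U (i + 1) = κ • U (i + 1)
  -- Only this relation needs a bound: with `U (i + 2) = 0` outside the alphabet it would kill the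
  -- last generator. The others survive the default value 0.
  up : ∀ i, i + 2 < n → U (i + 1) * U (i + 2) * U (i + 1) = U (i + 1)
  down : ∀ i, U (i + 2) * U (i + 1) * U (i + 2) = U (i + 2)
  comm : ∀ i j, i + 2 ≤ j → Commute (U i) (U j)
  U_e_U : U 1 * U 0 * U 1 = γ • U 1
  e_sq : U 0 * U 0 = δ • U 0

/-- `U_{a+t-1} ⋯ U_{a+1} U_a`. -/
def desc (U : ℕ → A) (a : ℕ) : ℕ → A
  | 0 => 1
  | t + 1 => U (a + t) * desc U a t

/-- `U_a U_{a+1} ⋯ U_{a+t-1}`. -/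
def asc (U : ℕ → A) (a : ℕ) : ℕ → A
  | 0 => 1
  | t + 1 => asc U a t * U (a + t)

/-- `U_1 U_3 ⋯ U_{2k-1}`. -/
def odds (U : ℕ → A) : ℕ → A
  | 0 => 1
  | k + 1 => odds U k * U (2 * k + 1)

/-- `U_{2k} ⋯ U_4 U_2`. -/
def evens (U : ℕ → A) : ℕ → A
  | 0 => 1
  | k + 1 => U (2 * k + 2) * evens U k

/-- `e (U_{2k} ⋯ U_2) (U_1 ⋯ U_{2k-1})`. -/
def decor (U : ℕ → A) (k : ℕ) : A := U 0 * evens U k * odds U k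

variable {U : ℕ → A} {n : ℕ} {κ γ δ : R}

theorem desc_add (a s t : ℕ) : desc U a (s + t) = desc U (a + s) t * desc U a s := by
  induction t with
  | zero => simp [desc]
  | succ t ih => rw [← add_assoc, desc, ih, desc, mul_assoc, add_assoc]

theorem desc_one_succ (l : ℕ) : desc U 1 (l + 1) = U (l + 1) * desc U 1 l := by
  rw [desc, add_comm 1 l]

namespace IsBlobFamily

variable (h : IsBlobFamily U n κ γ δ)

include h

theorem commute_desc {a t j : ℕ} (hj : a + t + 1 ≤ j) : Commute (U j) (desc U a t) := by
  induction t with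
  | zero => exact Commute.one_right _
  | succ t ih => exact ((h.comm _ _ (by omega)).symm).mul_right (ih (by omega))

theorem commute_odds {k j : ℕ} (hj : 2 * k + 1 ≤ j) : Commute (U j) (odds U k) := by
  induction k with
  | zero => exact Commute.one_right _
  | succ k ih => exact (ih (by omega)).mul_right (h.comm _ _ (by omega)).symm

theorem commute_evens {k j : ℕ} (hj : 2 * k + 2 ≤ j) : Commute (U j) (evens U k) := by
  induction k with
  | zero => exact Commute.one_right _
  | succ k ih => exact ((h.comm _ _ (by omega)).symm).mul_right (ih (by omega))

theorem commute_decor {k j : ℕ} (hj : 2 * k + 2 ≤ j) : Commute (U j) (decor U k) :=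
  (((h.comm _ _ (by omega)).symm).mul_right (h.commute_evens hj)).mul_right
    (h.commute_odds (by omega))

theorem commute_zero_evens (k : ℕ) : Commute (U 0) (evens U k) := by
  induction k with
  | zero => exact Commute.one_right _
  | succ k ih => exact (h.comm _ _ (by omega)).mul_right ih

theorem commute_desc_odds {k : ℕ} (t : ℕ) : Commute (desc U (2 * k + 1) t) (odds U k) := by
  induction t with
  | zero => exact Commute.one_left _
  | succ t ih => exact (h.commute_odds (by omega)).mul_left ih

/-- In the diagram of U_l ⋯ U_1 the through lines shift by two places. Algebraically, both sides of
the base case reduce to U_{s+3} U_{s+1} times the rest of the chain. -/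
theorem U_mul_desc {s l : ℕ} (hs : s + 3 ≤ l) (hl : l < n) :
    U (s + 1) * desc U 1 l = desc U 1 l * U (s + 3) := by
  obtain ⟨t, rfl⟩ := Nat.exists_eq_add_of_le hs
  induction t with
  | zero =>
    have hc : Commute (U (s + 3)) (desc U 1 s) := h.commute_desc (by omega)
    have hc' : Commute (U (s + 1)) (U (s + 3)) := h.comm _ _ (by omega)
    have hu := h.up s (by omega)
    have hd := h.down (s + 1)
    simp only [add_zero, desc_one_succ]
    calc U (s + 1) * (U (s + 3) * (U (s + 2) * (U (s + 1) * desc U 1 s)))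
        = (U (s + 1) * U (s + 3)) * U (s + 2) * U (s + 1) * desc U 1 s := by noncomm_ring
      _ = U (s + 3) * (U (s + 1) * U (s + 2) * U (s + 1)) * desc U 1 s := by
        rw [hc'.eq]; noncomm_ring
      _ = (U (s + 3) * U (s + 2) * U (s + 3)) * U (s + 1) * desc U 1 s := by rw [hu, hd]
      _ = U (s + 3) * U (s + 2) * (U (s + 3) * U (s + 1)) * desc U 1 s := by noncomm_ring
      _ = U (s + 3) * U (s + 2) * U (s + 1) * (U (s + 3) * desc U 1 s) := by
        rw [← hc'.eq]; noncomm_ring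
      _ = _ := by rw [hc.eq]; noncomm_ring
  | succ t ih =>
    rw [← add_assoc, desc_one_succ, ← mul_assoc, (h.comm _ _ (by omega)).eq, mul_assoc,
      ih (by omega) (by omega), mul_assoc]

theorem asc_mul_desc_one {a t l : ℕ} (hl : a + t + 2 ≤ l) (hn : l < n) :
    asc U (a + 1) t * desc U 1 l = desc U 1 l * asc U (a + 3) t := by
  induction t with
  | zero => simp [asc]
  | succ t ih =>
    rw [asc, asc, mul_assoc, add_right_comm, h.U_mul_desc (by omega) hn, ← mul_assoc,
      ih (by omega), mul_assoc, add_right_comm a 3 t]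

theorem desc_mul_desc_one {a t l : ℕ} (hl : a + t + 2 ≤ l) (hn : l < n) :
    desc U (a + 1) t * desc U 1 l = desc U 1 l * desc U (a + 3) t := by
  induction t with
  | zero => simp [desc]
  | succ t ih =>
    rw [desc, desc, mul_assoc, ih (by omega), ← mul_assoc, add_right_comm,
      h.U_mul_desc (by omega) hn, mul_assoc, add_right_comm a 3 t]

theorem odds_mul_desc_one {k : ℕ} (hk : 2 * k < n) : odds U k * desc U 1 (2 * k) = odds U k := by
  induction k with
  | zero => simp [desc]
  | succ k ih =>
    have hu := h.up (2 * k) (by omega)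
    have hc : Commute (U (2 * k + 1)) (odds U k) := h.commute_odds le_rfl
    rw [Nat.mul_succ, desc_one_succ, desc_one_succ, odds]
    calc odds U k * U (2 * k + 1) * (U (2 * k + 2) * (U (2 * k + 1) * desc U 1 (2 * k)))
        = odds U k * (U (2 * k + 1) * U (2 * k + 2) * U (2 * k + 1)) * desc U 1 (2 * k) := by
          noncomm_ring
      _ = U (2 * k + 1) * (odds U k * desc U 1 (2 * k)) := by rw [hu, ← hc.eq, mul_assoc]
      _ = _ := by rw [ih (by omega), hc.eq]

theorem odds_mul_desc_one_add {k t : ℕ} (hk : 2 * k < n) :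
    odds U k * desc U 1 (2 * k + t) = odds U k * desc U (2 * k + 1) t := by
  have hc := h.commute_desc_odds (k := k) t
  rw [desc_add, add_comm 1, ← mul_assoc, ← hc.eq, mul_assoc, h.odds_mul_desc_one hk]

/-- The row of k cups absorbs the lowest 2k letters of the chain, and the next letter U_{2k+1}
becomes a further cup: this is what a step toward 0 does. -/
theorem odds_mul_desc_one_add_succ {k t : ℕ} (hk : 2 * k < n) :
    odds U k * desc U 1 (2 * k + t + 1) = desc U (2 * k + 2) t * odds U (k + 1) := by
  have hc := h.commute_desc_odds (k := k) (t + 1)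
  rw [add_assoc, h.odds_mul_desc_one_add hk, ← hc.eq, add_comm t 1, desc_add, mul_assoc, odds,
    ← (h.commute_odds le_rfl).eq]
  simp [desc]

theorem asc_mul_desc_one_self {k t : ℕ} (ht : 2 * k + 2 + t < n) :
    asc U (2 * k + 2) t * desc U 1 (2 * k + 2 + t) = desc U 1 (2 * k + 2) := by
  induction t with
  | zero => simp [asc]
  | succ t ih =>
    have hu := h.up (2 * k + 1 + t) (by omega)
    rw [show 2 * k + 1 + t + 1 = 2 * k + 2 + t by omega,
      show 2 * k + 1 + t + 2 = 2 * k + 2 + t + 1 by omega] at hu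
    rw [← ih (by omega), asc, ← add_assoc, desc_one_succ,
      show 2 * k + 2 + t = (2 * k + 1 + t) + 1 by omega, desc_one_succ,
      show (2 * k + 1 + t) + 1 = 2 * k + 2 + t by omega]
    calc _ = asc U (2 * k + 2) t * (U (2 * k + 2 + t) * U (2 * k + 2 + t + 1) * U (2 * k + 2 + t)) *
        desc U 1 (2 * k + 1 + t) := by noncomm_ring
      _ = _ := by rw [hu]; noncomm_ring

theorem desc_one_mul_asc {k t : ℕ} :
    desc U 1 (2 * k + 1 + t) * asc U (2 * k + 2) t = U (2 * k + 1 + t) * desc U 1 (2 * k) := by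
  induction t with
  | zero => simp [asc, desc_one_succ]
  | succ t ih =>
    have hd := h.down (2 * k + t)
    have hc : Commute (U (2 * k + t + 2)) (desc U 1 (2 * k)) := h.commute_desc (by omega)
    rw [show 2 * k + t + 1 = 2 * k + 1 + t by omega] at hd
    rw [← add_assoc, desc_one_succ, asc, mul_assoc, ← mul_assoc (desc U 1 _), ih,
      show 2 * k + 1 + t + 1 = 2 * k + t + 2 by omega,
      show 2 * k + 2 + t = 2 * k + t + 2 by omega, mul_assoc, ← hc.eq, ← mul_assoc, ← mul_assoc, hd]

theorem decor_succ (k : ℕ) :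
    decor U (k + 1) = decor U k * (U (2 * k + 2) * U (2 * k + 1)) := by
  have h1 : Commute (U (2 * k + 2)) (evens U k) := h.commute_evens le_rfl
  have h2 : Commute (U (2 * k + 2)) (odds U k) := h.commute_odds (by omega)
  rw [decor, decor, evens, odds, h1.eq]
  calc _ = U 0 * evens U k * (U (2 * k + 2) * odds U k) * U (2 * k + 1) := by noncomm_ring
    _ = _ := by rw [h2.eq]; noncomm_ring

/-- The letters of the decoration shift by two in passing the chain. The innermost pair disappears
through U_2 U_1 U_2 = U_2, which frees e. -/
theorem desc_one_mul_decor {k l : ℕ} (hk : 2 * k + 2 ≤ l) (hl : l < n) :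
    desc U 1 l * decor U (k + 1) = decor U k * desc U 1 l := by
  induction k with
  | zero =>
    obtain ⟨t, rfl⟩ := Nat.exists_eq_add_of_le hk
    have hz : Commute (U 0) (desc U 3 t) := by
      clear hk hl
      induction t with
      | zero => exact Commute.one_right _
      | succ t ih => exact (h.comm _ _ (by omega)).mul_right ih
    have h2 : Commute (U 0) (U 2) := h.comm _ _ le_rfl
    rw [h.decor_succ, desc_add]
    simp only [decor, desc, evens, odds, mul_one, mul_zero, zero_add, add_zero]
    have hd := h.down 0
    simp only [zero_add] at hd
    calc desc U 3 t * (U 2 * U 1) * (U 0 * (U 2 * U 1))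
        = desc U 3 t * (U 2 * U 1 * (U 0 * U 2) * U 1) := by noncomm_ring
      _ = desc U 3 t * ((U 2 * U 1 * U 2) * U 0 * U 1) := by rw [h2.eq]; noncomm_ring
      _ = desc U 3 t * U 0 * (U 2 * U 1) := by rw [hd, ← h2.eq]; noncomm_ring
      _ = _ := by rw [← hz.eq, mul_assoc]
  | succ k ih =>
    have h1 := h.U_mul_desc (s := 2 * k) (l := l) (by omega) hl
    have h2 := h.U_mul_desc (s := 2 * k + 1) (l := l) (by omega) hl
    rw [h.decor_succ (k + 1), ← mul_assoc, ih (by omega), h.decor_succ k]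
    calc decor U k * desc U 1 l * (U (2 * k + 4) * U (2 * k + 3))
        = decor U k * (desc U 1 l * U (2 * k + 4)) * U (2 * k + 3) := by noncomm_ring
      _ = decor U k * U (2 * k + 2) * (desc U 1 l * U (2 * k + 3)) := by
        rw [← h2, mul_assoc, mul_assoc, mul_assoc]
      _ = _ := by rw [← h1]; noncomm_ring

theorem decor_mul_decor (k : ℕ) : decor U k * decor U k = δ • decor U k := by
  induction k with
  | zero => simpa [decor, evens, odds] using h.e_sq
  | succ k ih =>
    have hc : Commute (U (2 * k + 2)) (decor U k) := h.commute_decor le_rfl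
    have hd := h.down (2 * k)
    rw [h.decor_succ]
    calc _ = decor U k * (U (2 * k + 2) * U (2 * k + 1)) * (decor U k * U (2 * k + 2)) *
          U (2 * k + 1) := by noncomm_ring
      _ = decor U k * (U (2 * k + 2) * U (2 * k + 1) * U (2 * k + 2)) * decor U k *
          U (2 * k + 1) := by rw [← hc.eq]; noncomm_ring
      _ = decor U k * (U (2 * k + 2) * decor U k) * U (2 * k + 1) := by rw [hd]; noncomm_ring
      _ = (decor U k * decor U k) * (U (2 * k + 2) * U (2 * k + 1)) := by
        rw [hc.eq]; noncomm_ring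
      _ = _ := by rw [ih, smul_mul_assoc]

/-- A decorated closed loop contributes γ; every further pair of letters collapses by a zigzag
U_{2k+3} U_{2k+2} U_{2k+3} = U_{2k+3}. -/
theorem odds_mul_evens_mul_odds (k : ℕ) :
    odds U (k + 1) * (U 0 * evens U k) * odds U (k + 1) = γ • odds U (k + 1) := by
  induction k with
  | zero => simpa [evens, odds] using h.U_e_U
  | succ k ih =>
    have hc : Commute (U (2 * k + 3)) (odds U (k + 1)) := h.commute_odds (by omega)
    have h0 : Commute (U 0) (U (2 * k + 3)) := h.comm _ _ (by omega)
    have h2 : Commute (U 0) (U (2 * k + 2)) := h.comm _ _ (by omega)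
    have he : Commute (U (2 * k + 3)) (evens U k) := h.commute_evens (by omega)
    have hd := h.down (2 * k + 1)
    rw [odds, evens, show 2 * (k + 1) + 1 = 2 * k + 3 by omega]
    calc odds U (k + 1) * U (2 * k + 3) * (U 0 * (U (2 * k + 2) * evens U k)) *
          (odds U (k + 1) * U (2 * k + 3))
        = odds U (k + 1) * U (2 * k + 3) * (U 0 * (U (2 * k + 2) * evens U k)) *
          (U (2 * k + 3) * odds U (k + 1)) := by rw [hc.eq]
      _ = odds U (k + 1) * U (2 * k + 3) * (U 0 * U (2 * k + 2)) * evens U k *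
          (U (2 * k + 3) * odds U (k + 1)) := by noncomm_ring
      _ = odds U (k + 1) * (U (2 * k + 3) * U (2 * k + 2)) * U 0 * (evens U k * U (2 * k + 3)) *
          odds U (k + 1) := by rw [h2.eq]; noncomm_ring
      _ = odds U (k + 1) * (U (2 * k + 3) * U (2 * k + 2)) * (U 0 * U (2 * k + 3)) * evens U k *
          odds U (k + 1) := by rw [← he.eq]; noncomm_ring
      _ = odds U (k + 1) * (U (2 * k + 3) * U (2 * k + 2) * U (2 * k + 3)) * U 0 * evens U k *
          odds U (k + 1) := by rw [h0.eq]; noncomm_ring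
      _ = U (2 * k + 3) * (odds U (k + 1) * (U 0 * evens U k) * odds U (k + 1)) := by
        rw [hd, ← hc.eq]; noncomm_ring
      _ = _ := by rw [ih, mul_smul_comm, hc.eq]

end IsBlobFamily

end Relations

/-! ### Steps and letters of walks -/

section WalkCombinatorics

/-- Here `k` is the number of steps toward 0, that is, of cups. -/
theorem Walk.exists_eq_two_mul_add {N : ℕ} {m : ℤ} (p : Walk N m) :
    ∃ k, N = 2 * k + m.natAbs := by
  induction p with
  | start => exact ⟨0, rfl⟩
  | @step N m p m' h ih =>
    obtain ⟨k, hk⟩ := ih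
    by_cases hm : m.natAbs < m'.natAbs
    · exact ⟨k, by omega⟩
    · exact ⟨k + 1, by omega⟩

theorem edgeWord_zero_one (N : ℕ) :
    edgeWord N 0 1 = 0 :: (chainTwo N 2 ++ chainTwo (N - 1) 1) := by simp [edgeWord]

/-- The trichotomy behind the case splits on walk steps: decorated step 0 → 1, plain step away from
0, step toward 0. -/
theorem edgeWord_cases {m m' : ℤ} (N : ℕ) (h : m' = m + 1 ∨ m' = m - 1) :
    (m = 0 ∧ m' = 1) ∨
      (¬ (m = 0 ∧ m' = 1) ∧ m'.natAbs = m.natAbs + 1 ∧ edgeWord N m m' = []) ∨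
      (m'.natAbs + 1 = m.natAbs ∧ edgeWord N m m' = chain N 1) := by
  unfold edgeWord
  split_ifs <;> simp <;> omega

theorem mem_chain {i j a : ℕ} (ha : a ∈ chain i j) : a ≤ i ∧ j ≤ a := by
  simp only [chain, List.mem_map, List.mem_range] at ha
  omega

theorem mem_chainTwo {i j a : ℕ} (ha : a ∈ chainTwo i j) : a ≤ i := by
  unfold chainTwo at ha
  split_ifs at ha
  · simp only [List.mem_map] at ha
    omega
  · simp at ha

theorem mem_edgeWord {N : ℕ} {m m' : ℤ} {a : ℕ} (ha : a ∈ edgeWord N m m') : a ≤ N := by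
  unfold edgeWord at ha
  split_ifs at ha
  · simp only [List.mem_cons, List.mem_append] at ha
    rcases ha with rfl | ha | ha
    · exact Nat.zero_le _
    · exact mem_chainTwo ha
    · exact (mem_chainTwo ha).trans (Nat.sub_le _ _)
  · simp at ha
  · exact (mem_chain ha).1
  · simp at ha

theorem Walk.lt_of_mem_word {N : ℕ} {m : ℤ} (p : Walk N m) : ∀ i ∈ p.word, i < N := by
  induction p with
  | start => simp [Walk.word]
  | step p m' h ih =>
    intro i hi
    simp only [Walk.word, List.mem_append] at hi
    rcases hi with hi | hi
    · exact (ih i hi).trans (Nat.lt_succ_self _)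
    · exact Nat.lt_succ_of_le (mem_edgeWord hi)

end WalkCombinatorics

/-! ### Walk elements, reflection and joining of lines -/

section WalkElements

variable {R A : Type*} [CommRing R] [Ring A] [Algebra R A]

/-- The element named by a word, for a family of elements indexed by the letters. -/
def evalWord (U : ℕ → A) (w : Word) : A := (w.map U).prod

variable (U : ℕ → A)

@[simp] theorem evalWord_nil : evalWord U [] = 1 := rfl

@[simp] theorem evalWord_cons (i : ℕ) (w : Word) : evalWord U (i :: w) = U i * evalWord U w := by
  simp [evalWord]

@[simp] theorem evalWord_append (v w : Word) :
    evalWord U (v ++ w) = evalWord U v * evalWord U w := by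
  simp [evalWord]

theorem evalWord_map_range_sub (a t : ℕ) :
    evalWord U ((List.range t).map fun s => a + t - 1 - s) = desc U a t := by
  induction t with
  | zero => rfl
  | succ t ih =>
    rw [List.range_succ_eq_map, List.map_cons, evalWord_cons, List.map_map, desc, ← ih]
    congr 2
    refine List.map_congr_left fun s _ => ?_
    simp only [Function.comp_apply]
    omega

theorem evalWord_chain (i j : ℕ) : evalWord U (chain i j) = desc U j (i + 1 - j) := by
  rw [← evalWord_map_range_sub, chain]
  congr 1
  refine List.map_congr_left fun s hs => ?_
  rw [List.mem_range] at hs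
  omega

theorem evalWord_evens (k : ℕ) :
    evalWord U ((List.range k).map fun t => 2 * k - 2 * t) = evens U k := by
  induction k with
  | zero => rfl
  | succ k ih =>
    rw [List.range_succ_eq_map, List.map_cons, evalWord_cons, List.map_map, evens, ← ih]
    congr 2
    refine List.map_congr_left fun s _ => ?_
    simp only [Function.comp_apply]
    omega

theorem evalWord_chainTwo_two (k : ℕ) : evalWord U (chainTwo (2 * k) 2) = evens U k := by
  rw [← evalWord_evens]
  cases k with
  | zero => rfl
  | succ k =>
    have : Even (2 * (k + 1) - 2) := ⟨k, by omega⟩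
    rw [chainTwo, if_pos ⟨by omega, this⟩]
    congr 3
    omega

theorem evalWord_wordE {N m k : ℕ} (hk : N = 2 * k + m) : evalWord U (wordE N m) = odds U k := by
  have : (N - m) / 2 = k := by omega
  rw [wordE, this]
  clear this hk
  induction k with
  | zero => rfl
  | succ k ih => simp [List.range_succ, odds, ih]

variable {U} {n : ℕ} {κ γ δ : R}

namespace IsBlobFamily

variable (h : IsBlobFamily U n κ γ δ)

include h

theorem evalWord_chainTwo_one (k : ℕ) : evalWord U (chainTwo (2 * k - 1) 1) = odds U k := by
  have key : ∀ k, evalWord U ((List.range k).map fun t => 2 * k - 1 - 2 * t) = odds U k := by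
    intro k
    induction k with
    | zero => rfl
    | succ k ih =>
      rw [List.range_succ_eq_map, List.map_cons, evalWord_cons, List.map_map, odds,
        ← (h.commute_odds le_rfl).eq, ← ih]
      congr 2
      refine List.map_congr_left fun s _ => ?_
      simp only [Function.comp_apply]
      omega
  rw [← key]
  cases k with
  | zero => rfl
  | succ k =>
    have : Even (2 * (k + 1) - 1 - 1) := ⟨k, by omega⟩
    rw [chainTwo, if_pos ⟨by omega, this⟩]
    congr 3
    omega

theorem evalWord_edgeWord_zero_one (k : ℕ) : evalWord U (edgeWord (2 * k) 0 1) = decor U k := by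
  rw [edgeWord_zero_one, evalWord_cons, evalWord_append, evalWord_chainTwo_two,
    h.evalWord_chainTwo_one, decor, mul_assoc]

theorem evalWord_evens_asc (k : ℕ) :
    evalWord U ((List.range k).map fun t => 2 * t + 2) = evens U k := by
  induction k with
  | zero => rfl
  | succ k ih =>
    rw [evens, (h.commute_evens le_rfl).eq, ← ih]
    simp [List.range_succ]

theorem evalWord_wordEplus {N k : ℕ} {m : ℤ} (hk : N = 2 * k + m.natAbs) :
    evalWord U (wordEplus N m) = if 0 < m then odds U k * decor U k else odds U k := by
  have : (N - m.natAbs) / 2 = k := by omega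
  unfold wordEplus
  split_ifs
  · simp only [evalWord_append, evalWord_wordE U hk, evalWord_cons, evalWord_nil, this,
      h.evalWord_evens_asc, decor, mul_one, mul_assoc]
  · exact evalWord_wordE U hk

end IsBlobFamily

/-- The element named by the word of a walk. -/
def Walk.elt (U : ℕ → A) {N : ℕ} {m : ℤ} (p : Walk N m) : A := evalWord U p.word

theorem Walk.elt_start : Walk.elt U .start = 1 := rfl

theorem Walk.elt_step {N : ℕ} {m : ℤ} (p : Walk N m) (m' : ℤ) (h : m' = m + 1 ∨ m' = m - 1) :
    (Walk.step p m' h).elt U = p.elt U * evalWord U (edgeWord N m m') := by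
  simp [Walk.elt, Walk.word]

/-- `a` is the element of a walk of length `N` whose final weight has absolute value `l`. -/
def IsWalkElt (U : ℕ → A) (N l : ℕ) (a : A) : Prop :=
  ∃ m : ℤ, m.natAbs = l ∧ ∃ p : Walk N m, a = p.elt U

theorem Walk.isWalkElt {N : ℕ} {m : ℤ} (p : Walk N m) : IsWalkElt U N m.natAbs (p.elt U) :=
  ⟨m, rfl, p, rfl⟩

/-- Leaving 0 on the negative side avoids the decorated edge, so a step with empty word is always
available. -/
theorem IsWalkElt.away {N l : ℕ} {a : A} (ha : IsWalkElt U N l a) :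
    IsWalkElt U (N + 1) (l + 1) a := by
  obtain ⟨m, rfl, p, rfl⟩ := ha
  by_cases hm : m ≤ 0
  · have hs : m - 1 = m + 1 ∨ m - 1 = m - 1 := Or.inr rfl
    refine ⟨m - 1, by omega, .step p _ hs, ?_⟩
    rcases edgeWord_cases N hs with he | he | he
    · omega
    · rw [Walk.elt_step, he.2.2, evalWord_nil, mul_one]
    · omega
  · have hs : m + 1 = m + 1 ∨ m + 1 = m - 1 := Or.inl rfl
    refine ⟨m + 1, by omega, .step p _ hs, ?_⟩
    rcases edgeWord_cases N hs with he | he | he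
    · omega
    · rw [Walk.elt_step, he.2.2, evalWord_nil, mul_one]
    · omega

theorem IsWalkElt.toward {N l : ℕ} {a : A} (ha : IsWalkElt U N (l + 1) a) :
    IsWalkElt U (N + 1) l (a * desc U 1 N) := by
  obtain ⟨m, hl, p, rfl⟩ := ha
  by_cases hm : m ≤ 0
  · have hs : m + 1 = m + 1 ∨ m + 1 = m - 1 := Or.inl rfl
    refine ⟨m + 1, by omega, .step p _ hs, ?_⟩
    rcases edgeWord_cases N hs with he | he | he
    · omega
    · omega
    · rw [Walk.elt_step, he.2, evalWord_chain, Nat.add_sub_cancel]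
  · have hs : m - 1 = m + 1 ∨ m - 1 = m - 1 := Or.inr rfl
    refine ⟨m - 1, by omega, .step p _ hs, ?_⟩
    rcases edgeWord_cases N hs with he | he | he
    · omega
    · omega
    · rw [Walk.elt_step, he.2, evalWord_chain, Nat.add_sub_cancel]

namespace IsBlobFamily

variable (h : IsBlobFamily U n κ γ δ)

include h

theorem commute_elt {N : ℕ} {m : ℤ} (p : Walk N m) {j : ℕ} (hj : N + 1 ≤ j) :
    Commute (U j) (p.elt U) := by
  have key : ∀ w : Word, (∀ i ∈ w, i < N) → Commute (U j) (evalWord U w) := by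
    intro w
    induction w with
    | nil => intro _; exact Commute.one_right _
    | cons i w ih =>
      intro hw
      rw [evalWord_cons]
      have := hw i (by simp)
      exact ((h.comm i j (by omega)).symm).mul_right (ih fun a ha => hw a (by simp [ha]))
  exact key _ p.lt_of_mem_word

/-- Lets a walk element absorb on its right whatever the row of cups absorbs. -/
theorem exists_elt_eq_mul_odds {N : ℕ} {m : ℤ} (p : Walk N m) {k : ℕ} (hN : N ≤ n)
    (hk : N = 2 * k + m.natAbs) :
    ∃ v : Word, (∀ i ∈ v, i < N) ∧ p.elt U = evalWord U v * odds U k := by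
  induction p generalizing k with
  | start =>
    obtain rfl : k = 0 := by simp at hk; omega
    exact ⟨[], by simp, by simp [Walk.elt_start, odds]⟩
  | @step N m p m' hs ih =>
    rcases edgeWord_cases N hs with ⟨rfl, rfl⟩ | ⟨-, he, he'⟩ | ⟨he, he'⟩
    · obtain rfl : N = 2 * k := by simpa using hk
      refine ⟨p.word ++ 0 :: chainTwo (2 * k) 2, ?_, ?_⟩
      · intro i hi
        simp only [List.mem_append, List.mem_cons] at hi
        rcases hi with hi | rfl | hi
        · exact (p.lt_of_mem_word i hi).trans (Nat.lt_succ_self _)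
        · exact Nat.succ_pos _
        · exact Nat.lt_succ_of_le (mem_chainTwo hi)
      · rw [Walk.elt_step, h.evalWord_edgeWord_zero_one, decor, evalWord_append, evalWord_cons,
          evalWord_chainTwo_two, mul_assoc, mul_assoc, Walk.elt]
        simp only [mul_assoc]
    · obtain ⟨v, hv, hp⟩ := ih (k := k) (by omega) (by omega)
      refine ⟨v, fun i hi => (hv i hi).trans (Nat.lt_succ_self _), ?_⟩
      rw [Walk.elt_step, he', evalWord_nil, mul_one, hp]
    · obtain ⟨j, hj⟩ := p.exists_eq_two_mul_add
      obtain rfl : k = j + 1 := by omega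
      obtain ⟨v, hv, hp⟩ := ih (k := j) (by omega) (by omega)
      obtain ⟨t, ht⟩ : ∃ t, N = 2 * j + t + 1 := ⟨m'.natAbs, by omega⟩
      refine ⟨v ++ chain N (2 * j + 2), ?_, ?_⟩
      · intro i hi
        rcases List.mem_append.1 hi with hi | hi
        · exact (hv i hi).trans (Nat.lt_succ_self _)
        · exact Nat.lt_succ_of_le (mem_chain hi).1
      · rw [Walk.elt_step, he', hp, evalWord_chain, evalWord_append, evalWord_chain,
          Nat.add_sub_cancel, mul_assoc]
        conv_lhs => rw [ht, h.odds_mul_desc_one_add_succ (by omega)]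
        rw [mul_assoc]
        congr 3
        omega

theorem elt_mul_desc_one {N : ℕ} {m : ℤ} (p : Walk N m) {k t : ℕ} (hN : N ≤ n)
    (hk : N = 2 * k + m.natAbs) (hkn : 2 * k < n) :
    p.elt U * desc U 1 (2 * k + t) = p.elt U * desc U (2 * k + 1) t := by
  obtain ⟨v, -, hv⟩ := h.exists_elt_eq_mul_odds p hN hk
  rw [hv, mul_assoc, mul_assoc, h.odds_mul_desc_one_add hkn]

/-- Reflecting the last part of a walk with nonzero final weight, after its last visit to `0`. -/
theorem exists_reflect {N : ℕ} {m : ℤ} (p : Walk N m) {k : ℕ} (hN : N ≤ n)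
    (hk : N = 2 * k + m.natAbs) (hm : m ≠ 0) :
    ∃ q : Walk N (-m), (m < 0 → q.elt U = p.elt U * decor U k) ∧
      (0 < m → p.elt U = q.elt U * decor U k) := by
  induction p generalizing k with
  | start => exact absurd rfl hm
  | @step N m p m' hs ih =>
    have hs' : -m' = -m + 1 ∨ -m' = -m - 1 := by omega
    rcases edgeWord_cases N hs with ⟨rfl, rfl⟩ | ⟨hn, he, he'⟩ | ⟨he, he'⟩
    · obtain rfl : N = 2 * k := by simpa using hk
      refine ⟨.step p (-1) (Or.inr rfl), by omega, fun _ => ?_⟩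
      rw [Walk.elt_step, Walk.elt_step, h.evalWord_edgeWord_zero_one]
      simp [edgeWord]
    · by_cases h0 : m = 0
      · subst h0
        obtain rfl : m' = -1 := by omega
        obtain rfl : N = 2 * k := by simpa using hk
        refine ⟨.step p 1 (Or.inl rfl), fun _ => ?_, by omega⟩
        rw [Walk.elt_step (m' := -1), he', evalWord_nil, mul_one, ← h.evalWord_edgeWord_zero_one]
        exact Walk.elt_step p 1 _
      · obtain ⟨q, hq, hq'⟩ := ih (k := k) (by omega) (by omega) h0
        have hw : edgeWord N (-m) (-m') = [] := by
          rcases edgeWord_cases N hs' with e | e | e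
          · omega
          · exact e.2.2
          · omega
        refine ⟨.step q _ hs', fun h1 => ?_, fun h1 => ?_⟩
        · rw [Walk.elt_step, Walk.elt_step, hw, he', evalWord_nil, mul_one, mul_one, hq (by omega)]
        · rw [Walk.elt_step, Walk.elt_step, hw, he', evalWord_nil, mul_one, mul_one, hq' (by omega)]
    · obtain ⟨j, hj⟩ := p.exists_eq_two_mul_add
      obtain rfl : k = j + 1 := by omega
      obtain ⟨q, hq, hq'⟩ := ih (k := j) (by omega) (by omega) (by omega)
      have hw : edgeWord N (-m) (-m') = chain N 1 := by
        rcases edgeWord_cases N hs' with e | e | e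
        · omega
        · omega
        · exact e.2
      -- Sliding through the chain turns `decor U j` into `decor U (j + 1)`, the decoration matching
      -- the extra cup.
      have hc := h.desc_one_mul_decor (k := j) (l := N) (by omega) (by omega)
      refine ⟨.step q _ hs', fun h1 => ?_, fun h1 => ?_⟩
      · rw [Walk.elt_step, Walk.elt_step, hw, he', evalWord_chain, Nat.add_sub_cancel,
          hq (by omega), mul_assoc, mul_assoc, hc]
      · rw [Walk.elt_step, Walk.elt_step, hw, he', evalWord_chain, Nat.add_sub_cancel,
          hq' (by omega), mul_assoc, mul_assoc, hc]

/-- Weight -m is reflected to weight m; an element already of weight m is decorated twice, which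
costs δ. -/
theorem exists_elt_mul_decor {N k : ℕ} {m : ℤ} {a : A} (ha : IsWalkElt U N m.natAbs a) (hN : N ≤ n)
    (hk : N = 2 * k + m.natAbs) (hm : 0 < m) :
    ∃ (c : R) (q : Walk N m), a * decor U k = c • q.elt U := by
  obtain ⟨m', hm', p, rfl⟩ := ha
  obtain ⟨q, hq, hq'⟩ := h.exists_reflect p hN (hm' ▸ hk) (by omega)
  rcases Int.natAbs_eq_natAbs_iff.1 hm' with rfl | rfl
  · exact ⟨δ, p, by rw [hq' hm, mul_assoc, h.decor_mul_decor, mul_smul_comm]⟩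
  · have : ∃ q : Walk N (- -m), q.elt U = p.elt U * decor U k := ⟨q, hq (by omega)⟩
    rw [neg_neg] at this
    obtain ⟨q, hq⟩ := this
    exact ⟨1, q, by rw [hq, one_smul]⟩

/-- Joining two neighbouring lines of a walk. -/
theorem isWalkElt_mul_desc {N : ℕ} {m : ℤ} (p : Walk N m) {k t l : ℕ} (hN : N ≤ n)
    (hk : N = 2 * k + m.natAbs) (hl : m.natAbs = l + 2) (ht : t ≤ l) :
    IsWalkElt U N l (p.elt U * desc U (2 * k + 1) (t + 1)) := by
  induction p generalizing k t l with
  | start => simp at hl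
  | @step N m p m' hs ih =>
    rcases edgeWord_cases N hs with ⟨rfl, rfl⟩ | ⟨hn, he, he'⟩ | ⟨he, he'⟩
    · simp at hl
    · rw [Walk.elt_step, he', evalWord_nil, mul_one]
      rcases ht.lt_or_eq with ht | rfl
      · obtain ⟨l, rfl⟩ : ∃ l', l = l' + 1 := ⟨l - 1, by omega⟩
        exact (ih (by omega) (by omega) (by omega) (by omega)).away
      -- The outermost open line is joined: the cups supply the missing letters of the full chain,
      -- so the last step away is replaced by one toward 0.
      · rw [← h.elt_mul_desc_one p (by omega) (by omega) (by omega)]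
        have hp := p.isWalkElt (U := U)
        rw [show m.natAbs = t + 1 by omega] at hp
        rw [show 2 * k + (t + 1) = N by omega]
        exact hp.toward
    · obtain ⟨j, hj⟩ := p.exists_eq_two_mul_add
      obtain rfl : k = j + 1 := by omega
      rw [Walk.elt_step, he', evalWord_chain, Nat.add_sub_cancel, mul_assoc,
        show 2 * (j + 1) + 1 = 2 * j + 3 by omega,
        ← h.desc_mul_desc_one (by omega) (by omega), ← mul_assoc]
      exact (ih (k := j) (t := t) (l := l + 1) (by omega) (by omega) (by omega) (by omega)).toward

end IsBlobFamily

end WalkElements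

/-! ### The left action of the generators on walk elements -/

section LeftAction

variable {R A : Type*} [CommRing R] [Ring A] [Algebra R A]
variable {U : ℕ → A} {n : ℕ} {κ γ δ : R}

namespace IsBlobFamily

variable (h : IsBlobFamily U n κ γ δ)

include h

/-- `U_i` joins two lines at the outer end of a walk element: the result is an element of a walk
with two lines less, times a cap. -/
theorem U_mul_elt_eq_mul_asc {N : ℕ} {m : ℤ} (p : Walk N m) {k : ℕ} (hN : N + 2 ≤ n)
    (hk : N = 2 * k + m.natAbs) :
    ∃ a, IsWalkElt U (N + 2) m.natAbs a ∧
      U (N + 1) * p.elt U = a * asc U (2 * k + 2) m.natAbs := by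
  refine ⟨_, p.isWalkElt.away.toward, ?_⟩
  obtain ⟨v, -, hv⟩ := h.exists_elt_eq_mul_odds p (by omega) hk
  have hc : Commute (U (N + 1)) (odds U k) := h.commute_odds (by omega)
  have ha := h.desc_one_mul_asc (k := k) (t := m.natAbs)
  rw [show 2 * k + 1 + m.natAbs = N + 1 by omega] at ha
  rw [(h.commute_elt p le_rfl).eq, mul_assoc, ha, hv, mul_assoc, mul_assoc, ← mul_assoc (odds U k),
    ← hc.eq, mul_assoc, h.odds_mul_desc_one (by omega)]

theorem U_mul_elt_mul_decor_mul_desc {N : ℕ} (p : Walk N 0) {k : ℕ} (hN : N + 2 ≤ n)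
    (hk : N = 2 * k) :
    p.elt U * (U (N + 1) * decor U k * desc U 1 (N + 1)) = γ • (p.elt U * desc U 1 (N + 1)) := by
  obtain ⟨v, -, hv⟩ := h.exists_elt_eq_mul_odds p (k := k) (by omega) (by simpa using hk)
  subst hk
  have ho : odds U k * desc U 1 (2 * k + 1) = odds U (k + 1) := by
    have := h.odds_mul_desc_one_add_succ (k := k) (t := 0) (by omega)
    simpa [desc] using this
  rw [hv]
  calc _ = evalWord U v * ((odds U k * U (2 * k + 1)) * (U 0 * evens U k) *
        (odds U k * desc U 1 (2 * k + 1))) := by rw [decor]; simp only [mul_assoc]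
    _ = _ := by
      have := h.odds_mul_evens_mul_odds k
      rw [ho, ← odds, this, mul_smul_comm, mul_assoc, ho]

theorem isWalkElt_mul_desc_mul_desc {N : ℕ} {m : ℤ} (p : Walk N m) {l : ℕ} (hN : N + 2 ≤ n)
    (hl : m.natAbs = l + 2) :
    IsWalkElt U (N + 2) l (p.elt U * (desc U 1 (N + 1) * desc U 1 (N + 1))) := by
  obtain ⟨k, hk⟩ := p.exists_eq_two_mul_add
  have hq := h.isWalkElt_mul_desc p (t := l) (by omega) hk hl le_rfl
  obtain ⟨m', rfl, q, hq'⟩ := id hq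
  obtain ⟨v, -, hv⟩ := h.exists_elt_eq_mul_odds q (k := k + 1) (by omega) (by omega)
  have e : N + 1 = 2 * (k + 1) + (m'.natAbs + 1) := by omega
  have h1 : desc U 1 (N + 1) =
      desc U (2 * k + 3) (m'.natAbs + 1) * desc U 1 (2 * (k + 1)) := by
    rw [e, desc_add, show 1 + 2 * (k + 1) = 2 * k + 3 by omega]
  have hCC : desc U 1 (N + 1) * desc U 1 (N + 1) = desc U (2 * k + 1) (m'.natAbs + 1) *
      (desc U 1 (N + 1) * desc U 1 (2 * (k + 1))) := by
    calc _ = desc U 1 (N + 1) *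
          (desc U (2 * k + 3) (m'.natAbs + 1) * desc U 1 (2 * (k + 1))) := congrArg _ h1
      _ = _ := by rw [← mul_assoc, ← h.desc_mul_desc_one (by omega) (by omega), mul_assoc]
  have ho : odds U (k + 1) * (desc U 1 (N + 1) * desc U 1 (2 * (k + 1))) =
      odds U (k + 1) * desc U 1 (N + 1) := by
    rw [e, ← mul_assoc, h.odds_mul_desc_one_add (by omega), ← (h.commute_desc_odds _).eq, mul_assoc,
      h.odds_mul_desc_one (by omega)]
  have h2 : p.elt U * (desc U 1 (N + 1) * desc U 1 (N + 1)) = q.elt U * desc U 1 (N + 1) := by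
    rw [hCC, ← mul_assoc, hq', hv, mul_assoc, ho, mul_assoc]
  rw [h2, ← hq']
  exact hq.away.toward

/-- The cap is kept explicit, `t` being the number of open lines before it, so that the induction
can carry it through later steps. -/
theorem U_mul_elt {i : ℕ} (hi : 1 ≤ i) {N : ℕ} (hiN : i + 1 ≤ N) (hN : N ≤ n) :
    ∀ {m : ℤ} (p : Walk N m), m ≤ 0 →
      (∃ (c : R) (a : A), IsWalkElt U N m.natAbs a ∧ U i * p.elt U = c • a) ∨
      (∃ (k t l : ℕ) (a : A), N = 2 * k + m.natAbs ∧ m.natAbs = l + 2 ∧ t ≤ l ∧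
        IsWalkElt U N l a ∧ U i * p.elt U = a * asc U (2 * k + 2) t) := by
  obtain ⟨i, rfl⟩ : ∃ j, i = j + 1 := ⟨i - 1, by omega⟩
  induction N, hiN using Nat.le_induction with
  | base =>
    intro m p hm
    cases p with
    | @step _ m₁ p m hs =>
    cases p with
    | @step _ m₀ p m₁ hs' =>
    -- Only the last two steps meet U_{i+1}. Away then toward closes a loop, giving κ, or γ if
    -- decorated; away twice creates a cap; after a first step toward 0, U_{i+1} just lengthens its
    -- chain.
    have hc := (h.commute_elt p le_rfl).eq
    have hD : ∀ k, i = 2 * k → evalWord U (edgeWord i 0 1) = decor U k := by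
      rintro k rfl; exact h.evalWord_edgeWord_zero_one k
    simp only [Walk.elt_step]
    rw [← mul_assoc, ← mul_assoc, hc]
    obtain ⟨k, hk⟩ := p.exists_eq_two_mul_add
    have hsq : U (i + 1) * desc U 1 (i + 1) = κ • desc U 1 (i + 1) := by
      rw [desc_one_succ, ← mul_assoc, h.sq, smul_mul_assoc]
    rcases edgeWord_cases i hs' with ⟨rfl, rfl⟩ | ⟨hn, he, he'⟩ | ⟨he, he'⟩
    · rcases edgeWord_cases (i + 1) hs with e | e | ⟨e, e'⟩
      · omega
      · omega
      · refine Or.inl ⟨γ, p.elt U * desc U 1 (i + 1), ?_, ?_⟩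
        rotate_left
        · rw [hD k (by simpa using hk), e', evalWord_chain, Nat.add_sub_cancel]
          simp only [mul_assoc]
          simpa only [mul_assoc] using h.U_mul_elt_mul_decor_mul_desc p hN (by simpa using hk)
        · have := (p.isWalkElt (U := U)).away.toward
          rwa [show m.natAbs = Int.natAbs 0 by simp at e ⊢; omega]
    · rcases edgeWord_cases (i + 1) hs with e | ⟨-, e, e'⟩ | ⟨e, e'⟩
      · omega
      · obtain ⟨a, ha, ha'⟩ := h.U_mul_elt_eq_mul_asc p hN hk
        refine Or.inr ⟨k, m₀.natAbs, m₀.natAbs, a, by omega, by omega, le_rfl, ha, ?_⟩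
        rw [he', e', evalWord_nil, mul_one, mul_one, ← ha', hc]
      · refine Or.inl ⟨κ, p.elt U * desc U 1 (i + 1), ?_, ?_⟩
        rotate_left
        · rw [he', e', evalWord_nil, mul_one, evalWord_chain, Nat.add_sub_cancel, mul_assoc, hsq,
            mul_smul_comm]
        · have := (p.isWalkElt (U := U)).away.toward
          rwa [show m.natAbs = m₀.natAbs by omega]
    · rw [he', evalWord_chain, Nat.add_sub_cancel, mul_assoc (p.elt U), ← desc_one_succ]
      rcases edgeWord_cases (i + 1) hs with e | ⟨-, e, e'⟩ | ⟨e, e'⟩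
      · omega
      · refine Or.inl ⟨1, _, ?_, (one_smul _ _).symm⟩
        rw [e', evalWord_nil, mul_one, show m.natAbs = m₀.natAbs by omega]
        exact p.isWalkElt.away.toward
      · refine Or.inl ⟨1, _, ?_, (one_smul _ _).symm⟩
        rw [e', evalWord_chain, Nat.add_sub_cancel, mul_assoc]
        exact h.isWalkElt_mul_desc_mul_desc p hN (by omega)
  | succ N hiN ih =>
    intro m' p hm'
    cases p with
    | @step _ m p _ hs =>
    rw [Walk.elt_step, ← mul_assoc]
    rcases edgeWord_cases N hs with e | ⟨hn, he, he'⟩ | ⟨he, he'⟩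
    · omega
    · rw [he', evalWord_nil, mul_one]
      rcases ih (by omega) p (by omega) with ⟨c, a, ha, hca⟩ | ⟨k, t, l, a, hk, hl, ht, ha, hca⟩
      · exact Or.inl ⟨c, a, he ▸ ha.away, hca⟩
      · exact Or.inr ⟨k, t, l + 1, a, by omega, by omega, by omega, ha.away, hca⟩
    · rw [he', evalWord_chain, Nat.add_sub_cancel]
      by_cases hm : m ≤ 0
      · rcases ih (by omega) p hm with ⟨c, a, ha, hca⟩ | ⟨k, t, l, a, hk, hl, ht, ha, hca⟩
        · rw [← he] at ha
          exact Or.inl ⟨c, _, ha.toward, by rw [hca, smul_mul_assoc]⟩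
        · rcases ht.lt_or_eq with ht | rfl
          · obtain ⟨l, rfl⟩ : ∃ l', l = l' + 1 := ⟨l - 1, by omega⟩
            refine Or.inr ⟨k + 1, t, l, _, by omega, by omega, by omega, ha.toward, ?_⟩
            rw [hca, mul_assoc, h.asc_mul_desc_one (by omega) (by omega), mul_assoc]
            rfl
          -- The cap sits on the two outermost open lines, and the step toward 0 straightens it: the
          -- ascending chain cancels, and the cups of `q` absorb the rest.
          · have ha' := ha.away
            obtain ⟨m₂, hm₂, q, rfl⟩ := ha
            have hNk : N = 2 * k + 2 + t := by omega
            refine Or.inl ⟨1, q.elt U, ?_, ?_⟩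
            · rwa [show m'.natAbs = t + 1 by omega]
            · rw [hca, mul_assoc, one_smul]
              have hs := h.asc_mul_desc_one_self (k := k) (t := t) (by omega)
              rw [← hNk] at hs
              rw [hs]
              have := h.elt_mul_desc_one q (k := k + 1) (t := 0) (by omega) (by omega) (by omega)
              rw [add_zero] at this
              exact this.trans (mul_one _)
      -- A positive weight can only have come down from 1 to 0. Reflect to weight -1, where no cap
      -- fits on a single open line, and restore the decoration afterwards.
      · obtain rfl : m = 1 := by omega
        obtain rfl : m' = 0 := by omega
        obtain ⟨k, hk⟩ := p.exists_eq_two_mul_add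
        obtain ⟨q, -, hq⟩ := h.exists_reflect p (by omega) hk one_ne_zero
        rcases ih (by omega) q (by omega) with ⟨c, a, ha, hca⟩ | ⟨k, t, l, a, hk, hl, ht, ha, hca⟩
        · obtain ⟨c', q', hq'⟩ := h.exists_elt_mul_decor (m := 1) (k := k) ha (by omega) hk one_pos
          refine Or.inl ⟨c * c', q'.elt U * desc U 1 N, ?_, ?_⟩
          · have := q'.isWalkElt (U := U)
            exact this.toward
          · rw [hq one_pos, ← mul_assoc, hca, smul_mul_assoc, hq', smul_mul_assoc, smul_mul_assoc,
              smul_smul]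
        · simp at hl

theorem e_mul_elt {N : ℕ} {m : ℤ} (p : Walk N m) (hN : 1 ≤ N) :
    (∃ (c : R) (q : Walk N m), U 0 * p.elt U = c • q.elt U) ∨
      (m < 0 ∧ ∃ q : Walk N (-m), U 0 * p.elt U = q.elt U) := by
  induction p with
  | start => omega
  | @step N m p m' hs ih =>
    rcases Nat.eq_zero_or_pos N with rfl | hN
    · cases p with
      | start =>
      have h1 : ∀ hs, (Walk.step .start 1 hs).elt U = U 0 := by
        intro hs
        rw [Walk.elt_step, Walk.elt_start, one_mul]
        simp [edgeWord, chainTwo]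
      obtain rfl | rfl : m' = 1 ∨ m' = -1 := by omega
      · exact Or.inl ⟨δ, .step .start 1 hs, by rw [h1, h.e_sq]⟩
      · refine Or.inr ⟨by omega, .step .start 1 (Or.inl rfl), ?_⟩
        have h2 : (Walk.step .start (-1) hs).elt U = 1 := by
          rw [Walk.elt_step, Walk.elt_start, one_mul]
          simp [edgeWord]
        rw [h2, mul_one]
        exact (h1 _).symm
    · rcases ih hN with ⟨c, q, hq⟩ | ⟨hm, q, hq⟩
      · exact Or.inl ⟨c, .step q m' hs, by
          rw [Walk.elt_step, Walk.elt_step, ← mul_assoc, hq, smul_mul_assoc]⟩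
      -- Away from weight 0 an edge word ignores signs, so the mirrored walk can be followed until
      -- it returns to 0 and the two weights agree.
      · have hw : edgeWord N (-m) (-m') = edgeWord N m m' := by
          simp [edgeWord, hm.ne]
        have hs' : -m' = -m + 1 ∨ -m' = -m - 1 := by omega
        have hq' : U 0 * (Walk.step p m' hs).elt U = (Walk.step q (-m') hs').elt U := by
          rw [Walk.elt_step, Walk.elt_step, ← mul_assoc, hq, hw]
        by_cases h0 : m' = 0
        · subst h0
          exact Or.inl ⟨1, .step q (-0) hs', by rw [one_smul]; exact hq'⟩
        · exact Or.inr ⟨by omega, _, hq'⟩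

/-- The left action of the generators on walk elements. -/
theorem U_mul_walk {i : ℕ} (hi : i < n) {m : ℤ} (p : Walk n m) :
    (∃ (c : R) (q : Walk n m), U i * p.elt U = c • q.elt U) ∨
      (m < 0 ∧ ∃ (c : R) (q : Walk n (-m)), U i * p.elt U = c • q.elt U) ∨
      ∃ (m' : ℤ) (q : Walk n m') (y : A), m'.natAbs < m.natAbs ∧ U i * p.elt U = q.elt U * y := by
  rcases Nat.eq_zero_or_pos i with rfl | hi0
  · rcases h.e_mul_elt p hi with h1 | ⟨hm, q, hq⟩
    · exact Or.inl h1
    · exact Or.inr (Or.inl ⟨hm, 1, q, by rw [hq, one_smul]⟩)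
  · by_cases hm : m ≤ 0
    · rcases h.U_mul_elt hi0 hi le_rfl p hm with
        ⟨c, a, ⟨m', hm', q, rfl⟩, hca⟩ | ⟨k, t, l, a, hk, hl, ht, ⟨m', hm', q, rfl⟩, hca⟩
      · rcases Int.natAbs_eq_natAbs_iff.1 hm' with rfl | rfl
        · exact Or.inl ⟨c, q, hca⟩
        · rcases hm.lt_or_eq with hm | rfl
          · exact Or.inr (Or.inl ⟨hm, c, q, hca⟩)
          · exact Or.inl ⟨c, q, hca⟩
      · exact Or.inr (Or.inr ⟨m', q, _, by omega, hca⟩)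
    · obtain ⟨k, hk⟩ := p.exists_eq_two_mul_add
      obtain ⟨q, -, hq⟩ := h.exists_reflect p le_rfl hk (by omega)
      have hq := hq (by omega)
      rcases h.U_mul_elt hi0 hi le_rfl q (by omega) with
        ⟨c, a, ha, hca⟩ | ⟨k, t, l, a, hk, hl, ht, ⟨m', hm', q, rfl⟩, hca⟩
      · rw [Int.natAbs_neg] at ha
        obtain ⟨c', q', hq'⟩ := h.exists_elt_mul_decor ha le_rfl hk (by omega)
        exact Or.inl ⟨c * c', q', by
          rw [hq, ← mul_assoc, hca, smul_mul_assoc, hq', smul_smul]⟩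
      · exact Or.inr (Or.inr ⟨m', q, _, by omega, by rw [hq, ← mul_assoc, hca, mul_assoc]⟩)

/-- The element named by `E_{m+}` comes from a walk. -/
theorem exists_elt_eq_wordEplus {N : ℕ} {m : ℤ} (p : Walk N m) (hN : N ≤ n) :
    ∃ q : Walk N m, q.elt U = evalWord U (wordEplus N m) := by
  obtain ⟨k, hk⟩ := p.exists_eq_two_mul_add
  -- The walk zigzags k times between 0 and -1, then runs straight to -|m|, and is reflected if m >
  -- 0. The given `p` only supplies parity and |m| ≤ N.
  have h0 : ∀ k, 2 * k ≤ n → ∃ q : Walk (2 * k) 0, q.elt U = odds U k := by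
    intro k
    induction k with
    | zero => exact fun _ => ⟨.start, rfl⟩
    | succ k ih =>
      intro hk
      obtain ⟨q, hq⟩ := ih (by omega)
      refine ⟨.step (.step q (-1) (Or.inr rfl)) 0 (Or.inl rfl), ?_⟩
      have := h.odds_mul_desc_one_add_succ (k := k) (t := 0) (by omega)
      rw [Walk.elt_step, Walk.elt_step, hq]
      simpa [edgeWord, evalWord_chain, desc] using this
  have h1 : ∀ l : ℕ, 2 * k + l ≤ n → ∃ q : Walk (2 * k + l) (-l : ℤ), q.elt U = odds U k := by
    intro l
    induction l with
    | zero => exact fun hl => h0 k hl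
    | succ l ih =>
      intro hl
      obtain ⟨q, hq⟩ := ih (by omega)
      have hs : (-(l + 1 : ℕ) : ℤ) = -l + 1 ∨ (-(l + 1 : ℕ) : ℤ) = -l - 1 := by omega
      refine ⟨.step q _ hs, ?_⟩
      rcases edgeWord_cases (2 * k + l) hs with e | e | e
      · omega
      · rw [Walk.elt_step, hq, e.2.2, evalWord_nil, mul_one]
      · omega
  have h2 := h1 m.natAbs (by omega)
  rw [← hk] at h2
  rw [h.evalWord_wordEplus hk]
  split_ifs with hm
  · rw [show -(m.natAbs : ℤ) = -m by omega] at h2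
    obtain ⟨q, hq⟩ := h2
    obtain ⟨q', hq', -⟩ := h.exists_reflect q (k := k) hN (by omega) (by omega)
    have h3 : ∃ q' : Walk N (- -m), q'.elt U = odds U k * decor U k := ⟨q', by
      rw [hq' (by omega), hq]⟩
    rwa [neg_neg] at h3
  · rwa [show -(m.natAbs : ℤ) = m by omega] at h2

end IsBlobFamily

end LeftAction

/-! ### Two-sided ideals as submodules -/

section IdealSpan

variable {R A : Type*} [CommRing R] [Ring A] [Algebra R A] {S : Set A}

theorem subset_idealSpan : S ⊆ idealSpan R S := fun _ ha => TwoSidedIdeal.subset_span ha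

theorem mul_mem_idealSpan_left (a : A) {y : A} (hy : y ∈ idealSpan R S) :
    a * y ∈ idealSpan R S :=
  TwoSidedIdeal.mul_mem_left (TwoSidedIdeal.span S) a y hy

theorem mul_mem_idealSpan_right (a : A) {y : A} (hy : y ∈ idealSpan R S) :
    y * a ∈ idealSpan R S :=
  TwoSidedIdeal.mul_mem_right (TwoSidedIdeal.span S) y a hy

theorem idealSpan_le {P : Submodule R A} (hS : S ⊆ P) (hl : ∀ a, ∀ y ∈ P, a * y ∈ P)
    (hr : ∀ a, ∀ y ∈ P, y * a ∈ P) : idealSpan R S ≤ P := by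
  let I : TwoSidedIdeal A := .mk' P P.zero_mem P.add_mem P.neg_mem (hl _ _) (hr _ _)
  have hI : ∀ y, y ∈ I ↔ y ∈ P := fun y => TwoSidedIdeal.mem_mk' _ _ _ _ _ _ y
  have : TwoSidedIdeal.span S ≤ I := TwoSidedIdeal.span_le.2 fun y hy => (hI y).2 (hS hy)
  exact fun y hy => (hI y).1 (this hy)

end IdealSpan

/-! ### From the left action to the two spanning statements -/

section Spanning

variable {R A : Type*} [CommRing R] [Ring A] [Algebra R A]
variable {U : ℕ → A} {n : ℕ} {κ γ δ : R}

/-- The set `{a E_{m+} σ(b) | a, b ∈ s}`. -/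
def sqSet (U : ℕ → A) (σ : A →ₗ[R] A) (n : ℕ) (m : ℤ) (s : Set Word) : Set A :=
  {y | ∃ a ∈ s, ∃ b ∈ s, y = evalWord U a * evalWord U (wordEplus n m) * σ (evalWord U b)}

/-- The walk elements of weight `m` are the products `w E_{m+}` with `w ∈ s`. -/
def IsCoeff (U : ℕ → A) (n : ℕ) (m : ℤ) (s : Set Word) : Prop :=
  (Set.range fun p : Walk n m => p.elt U) =
    {y | ∃ w ∈ s, y = evalWord U w * evalWord U (wordEplus n m)}

theorem exists_walk_neg (n : ℕ) : Nonempty (Walk n (-n : ℤ)) := by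
  induction n with
  | zero => exact ⟨.start⟩
  | succ n ih =>
    obtain ⟨p⟩ := ih
    exact ⟨.step p _ (by omega)⟩

/-- An anti-endomorphism of the algebra that fixes the generators. -/
structure IsReversal (U : ℕ → A) (σ : A →ₗ[R] A) : Prop where
  map_one : σ 1 = 1
  map_mul : ∀ a b, σ (a * b) = σ b * σ a
  map_U : ∀ i, σ (U i) = U i

/-- The sum of the ideals that precede weight `m`. -/
def lowerIdeal (U : ℕ → A) (σ : A →ₗ[R] A) (n : ℕ) (s : ℤ → Set Word) (m : ℤ) : Submodule R A :=
  ⨆ m' : ℤ, ⨆ _ : |m'| < |m| ∨ (m < 0 ∧ m' = -m), idealSpan R (sqSet U σ n m' (s m'))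

theorem idealSpan_le_lowerIdeal {σ : A →ₗ[R] A} {s : ℤ → Set Word} {m m' : ℤ}
    (hm : |m'| < |m| ∨ (m < 0 ∧ m' = -m)) :
    idealSpan R (sqSet U σ n m' (s m')) ≤ lowerIdeal U σ n s m :=
  le_iSup₂_of_le m' hm le_rfl

theorem mul_mem_lowerIdeal_left {σ : A →ₗ[R] A} {s : ℤ → Set Word} {m : ℤ} (a : A) {y : A}
    (hy : y ∈ lowerIdeal U σ n s m) : a * y ∈ lowerIdeal U σ n s m := by
  have : lowerIdeal U σ n s m ≤ (lowerIdeal U σ n s m).comap (LinearMap.mulLeft R a) :=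
    iSup₂_le fun m' hm y hy => idealSpan_le_lowerIdeal hm (mul_mem_idealSpan_left a hy)
  exact this hy

theorem mul_mem_lowerIdeal_right {σ : A →ₗ[R] A} {s : ℤ → Set Word} {m : ℤ} (a : A) {y : A}
    (hy : y ∈ lowerIdeal U σ n s m) : y * a ∈ lowerIdeal U σ n s m := by
  have : lowerIdeal U σ n s m ≤ (lowerIdeal U σ n s m).comap (LinearMap.mulRight R a) :=
    iSup₂_le fun m' hm y hy => idealSpan_le_lowerIdeal hm (mul_mem_idealSpan_right a hy)
  exact this hy

namespace IsBlobFamily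

variable (h : IsBlobFamily U n κ γ δ)

include h

theorem exists_elt_eq_mul_wordEplus {m : ℤ} (p : Walk n m) :
    ∃ v : Word, (∀ i ∈ v, i < n) ∧ p.elt U = evalWord U v * evalWord U (wordEplus n m) := by
  obtain ⟨k, hk⟩ := p.exists_eq_two_mul_add
  rw [h.evalWord_wordEplus hk]
  split_ifs with hm
  · obtain ⟨q, -, hq⟩ := h.exists_reflect p le_rfl hk hm.ne'
    obtain ⟨v, hv, hqv⟩ := h.exists_elt_eq_mul_odds q (k := k) le_rfl (by omega)
    exact ⟨v, hv, by rw [hq hm, hqv, mul_assoc]⟩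
  · exact h.exists_elt_eq_mul_odds p le_rfl hk

theorem exists_isCoeff (m : ℤ) : ∃ s : Set Word, (∀ w ∈ s, ∀ i ∈ w, i < n) ∧ IsCoeff U n m s := by
  refine ⟨{w | (∀ i ∈ w, i < n) ∧
    ∃ p : Walk n m, p.elt U = evalWord U w * evalWord U (wordEplus n m)}, fun w hw => hw.1, ?_⟩
  ext y
  constructor
  · rintro ⟨p, rfl⟩
    obtain ⟨v, hv, hp⟩ := h.exists_elt_eq_mul_wordEplus p
    exact ⟨v, ⟨hv, p, hp⟩, hp⟩
  · rintro ⟨w, ⟨-, p, hp⟩, rfl⟩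
    exact ⟨p, hp⟩

variable {σ : A →ₗ[R] A} (hσ : IsReversal U σ)

include hσ

theorem map_wordEplus {m : ℤ} (p : Walk n m) :
    σ (evalWord U (wordEplus n m)) = evalWord U (wordEplus n m) := by
  obtain ⟨k, hk⟩ := p.exists_eq_two_mul_add
  have ho : ∀ k, σ (odds U k) = odds U k := by
    intro k
    induction k with
    | zero => exact hσ.map_one
    | succ k ih => rw [odds, hσ.map_mul, hσ.map_U, ih, (h.commute_odds le_rfl).eq]
  have he : ∀ k, σ (evens U k) = evens U k := by
    intro k
    induction k with
    | zero => exact hσ.map_one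
    | succ k ih => rw [evens, hσ.map_mul, hσ.map_U, ih, (h.commute_evens le_rfl).eq]
  rw [h.evalWord_wordEplus hk]
  split_ifs
  · rw [hσ.map_mul, decor, hσ.map_mul, hσ.map_mul, ho, he, hσ.map_U,
      ← (h.commute_zero_evens k).eq, mul_assoc]
  · exact ho k

section

variable {m : ℤ} {s : Set Word} (hs : IsCoeff U n m s)

include hs

omit h hσ in
theorem exists_mem_coeff (p : Walk n m) :
    ∃ a ∈ s, p.elt U = evalWord U a * evalWord U (wordEplus n m) :=
  hs.subset ⟨p, rfl⟩

omit h hσ in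
theorem exists_walk_of_mem {a : Word} (ha : a ∈ s) :
    ∃ p : Walk n m, p.elt U = evalWord U a * evalWord U (wordEplus n m) :=
  hs.superset ⟨a, ha, rfl⟩

omit h hσ in
theorem elt_mul_mem_sqSet (p : Walk n m) {b : Word} (hb : b ∈ s) :
    p.elt U * σ (evalWord U b) ∈ sqSet U σ n m s := by
  obtain ⟨a, ha, hp⟩ := exists_mem_coeff hs p
  exact ⟨a, ha, b, hb, by rw [hp]⟩

theorem mul_map_elt_mem_sqSet {a : Word} (ha : a ∈ s) (p : Walk n m) :
    evalWord U a * σ (p.elt U) ∈ sqSet U σ n m s := by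
  obtain ⟨b, hb, hp⟩ := exists_mem_coeff hs p
  exact ⟨a, ha, b, hb, by rw [hp, hσ.map_mul, h.map_wordEplus hσ p, mul_assoc]⟩

/-- Write the element as a E_{m+}; as E_{m+} is a reversed walk element, it equals E_{m+} σ(b) for
some b in `s`. This places error terms in the preceding ideals. -/
theorem elt_mem_sqSet (p : Walk n m) : p.elt U ∈ sqSet U σ n m s := by
  obtain ⟨q, hq⟩ := h.exists_elt_eq_wordEplus p le_rfl
  obtain ⟨a, ha, hp⟩ := exists_mem_coeff hs p
  have := h.mul_map_elt_mem_sqSet hσ hs ha q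
  rwa [hq, h.map_wordEplus hσ p, ← hp] at this

theorem map_elt_mem_sqSet (p : Walk n m) : σ (p.elt U) ∈ sqSet U σ n m s := by
  obtain ⟨q, hq⟩ := h.exists_elt_eq_wordEplus p le_rfl
  obtain ⟨a, ha, hp⟩ := exists_mem_coeff hs p
  have := elt_mul_mem_sqSet (σ := σ) hs q ha
  rwa [hq, ← h.map_wordEplus hσ p, ← hσ.map_mul, ← hp] at this

end

variable {s : ℤ → Set Word} (hs : ∀ m, IsCoeff U n m (s m))

include hs

theorem U_mul_mem {i : ℕ} (hi : i < n) {m : ℤ} {y : A}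
    (hy : y ∈ Submodule.span R (sqSet U σ n m (s m)) ⊔ lowerIdeal U σ n s m) :
    U i * y ∈ Submodule.span R (sqSet U σ n m (s m)) ⊔ lowerIdeal U σ n s m := by
  set P := Submodule.span R (sqSet U σ n m (s m)) ⊔ lowerIdeal U σ n s m with hP
  have : P ≤ P.comap (LinearMap.mulLeft R (U i)) := by
    refine sup_le (Submodule.span_le.2 ?_)
      fun z hz => Submodule.mem_sup_right (mul_mem_lowerIdeal_left _ hz)
    rintro _ ⟨a, ha, b, hb, rfl⟩
    obtain ⟨p, hp⟩ := exists_walk_of_mem (hs m) ha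
    change U i * _ ∈ P
    rw [← hp, ← mul_assoc]
    rcases h.U_mul_walk hi p with ⟨c, q, hq⟩ | ⟨hm, c, q, hq⟩ | ⟨m', q, z, hm, hq⟩
    · rw [hq, smul_mul_assoc]
      exact Submodule.mem_sup_left (Submodule.smul_mem _ _
        (Submodule.subset_span (elt_mul_mem_sqSet (hs m) q hb)))
    · rw [hq, smul_mul_assoc]
      exact Submodule.mem_sup_right (Submodule.smul_mem _ _
        (idealSpan_le_lowerIdeal (Or.inr ⟨hm, rfl⟩) (mul_mem_idealSpan_right _
          (subset_idealSpan (h.elt_mem_sqSet hσ (hs _) q)))))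
    · rw [hq, mul_assoc]
      exact Submodule.mem_sup_right (idealSpan_le_lowerIdeal (Or.inl (by
        rwa [Int.abs_eq_natAbs, Int.abs_eq_natAbs, Nat.cast_lt]))
        (mul_mem_idealSpan_right _ (subset_idealSpan (h.elt_mem_sqSet hσ (hs _) q))))
  exact this hy

theorem mul_U_mem {i : ℕ} (hi : i < n) {m : ℤ} {y : A}
    (hy : y ∈ Submodule.span R (sqSet U σ n m (s m)) ⊔ lowerIdeal U σ n s m) :
    y * U i ∈ Submodule.span R (sqSet U σ n m (s m)) ⊔ lowerIdeal U σ n s m := by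
  set P := Submodule.span R (sqSet U σ n m (s m)) ⊔ lowerIdeal U σ n s m with hP
  have : P ≤ P.comap (LinearMap.mulRight R (U i)) := by
    refine sup_le (Submodule.span_le.2 ?_)
      fun z hz => Submodule.mem_sup_right (mul_mem_lowerIdeal_right _ hz)
    rintro _ ⟨a, ha, b, hb, rfl⟩
    obtain ⟨p, hp⟩ := exists_walk_of_mem (hs m) hb
    change _ * U i ∈ P
    -- Under the reversal, right multiplication becomes the left action on the walk of `b`.
    have e : evalWord U a * evalWord U (wordEplus n m) * σ (evalWord U b) * U i =
        evalWord U a * σ (U i * p.elt U) := by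
      rw [hσ.map_mul, hp, hσ.map_mul, h.map_wordEplus hσ p, hσ.map_U]
      simp only [mul_assoc]
    rw [e]
    rcases h.U_mul_walk hi p with ⟨c, q, hq⟩ | ⟨hm, c, q, hq⟩ | ⟨m', q, z, hm, hq⟩
    · rw [hq, map_smul, mul_smul_comm]
      exact Submodule.mem_sup_left (Submodule.smul_mem _ _
        (Submodule.subset_span (h.mul_map_elt_mem_sqSet hσ (hs m) ha q)))
    · rw [hq, map_smul, mul_smul_comm]
      exact Submodule.mem_sup_right (Submodule.smul_mem _ _
        (idealSpan_le_lowerIdeal (Or.inr ⟨hm, rfl⟩) (mul_mem_idealSpan_left _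
          (subset_idealSpan (h.map_elt_mem_sqSet hσ (hs _) q)))))
    · rw [hq, hσ.map_mul, ← mul_assoc]
      exact Submodule.mem_sup_right (idealSpan_le_lowerIdeal (Or.inl (by
        rwa [Int.abs_eq_natAbs, Int.abs_eq_natAbs, Nat.cast_lt]))
        (mul_mem_idealSpan_left _ (subset_idealSpan (h.map_elt_mem_sqSet hσ (hs _) q))))
  exact this hy

variable (hgen : ∀ S : Subalgebra R A, (∀ i < n, U i ∈ S) → S = ⊤)

include hgen

theorem idealSpan_sqSet_le (m : ℤ) :
    idealSpan R (sqSet U σ n m (s m)) ≤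
      Submodule.span R (sqSet U σ n m (s m)) ⊔ lowerIdeal U σ n s m := by
  set P := Submodule.span R (sqSet U σ n m (s m)) ⊔ lowerIdeal U σ n s m with hP
  refine idealSpan_le (Submodule.subset_span.trans (le_sup_left : _ ≤ P)) ?_ ?_
  -- The elements that preserve `P` form a subalgebra, so checking the generators suffices.
  · let S : Subalgebra R A :=
      { carrier := {a | ∀ y ∈ P, a * y ∈ P}
        mul_mem' := fun {a b} ha hb y hy => by rw [mul_assoc]; exact ha _ (hb _ hy)
        add_mem' := fun {a b} ha hb y hy => by rw [add_mul]; exact P.add_mem (ha _ hy) (hb _ hy)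
        algebraMap_mem' := fun c y hy => by
          rw [← Algebra.smul_def]; exact P.smul_mem c hy }
    have hS : S = ⊤ := hgen S fun i hi y hy => h.U_mul_mem hσ hs hi hy
    exact fun a => (hS ▸ Algebra.mem_top : a ∈ S)
  · let S : Subalgebra R A :=
      { carrier := {a | ∀ y ∈ P, y * a ∈ P}
        mul_mem' := fun {a b} ha hb y hy => by rw [← mul_assoc]; exact hb _ (ha _ hy)
        add_mem' := fun {a b} ha hb y hy => by rw [mul_add]; exact P.add_mem (ha _ hy) (hb _ hy)
        algebraMap_mem' := fun c y hy => by
          rw [← Algebra.commutes, ← Algebra.smul_def]; exact P.smul_mem c hy }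
    have hS : S = ⊤ := hgen S fun i hi y hy => h.mul_U_mem hσ hs hi hy
    exact fun a => (hS ▸ Algebra.mem_top : a ∈ S)

theorem idealSpan_sqSet_sup_lowerIdeal (m : ℤ) :
    idealSpan R (sqSet U σ n m (s m)) ⊔ lowerIdeal U σ n s m =
      Submodule.span R (sqSet U σ n m (s m)) ⊔ lowerIdeal U σ n s m :=
  le_antisymm (sup_le (h.idealSpan_sqSet_le hσ hs hgen m) le_sup_right)
    (sup_le_sup_right (Submodule.span_le.2 subset_idealSpan) _)

theorem span_iUnion_sqSet : Submodule.span R (⋃ m : ℤ, sqSet U σ n m (s m)) = ⊤ := by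
  -- The number `d` encodes the order 0, 1, -1, 2, -2, … and drops at every weight occurring in
  -- `lowerIdeal`.
  have key : ∀ (d : ℕ) (m : ℤ), 2 * m.natAbs + (if m < 0 then 1 else 0) = d →
      idealSpan R (sqSet U σ n m (s m)) ≤ Submodule.span R (⋃ m : ℤ, sqSet U σ n m (s m)) := by
    intro d
    induction d using Nat.strong_induction_on with
    | _ d ih =>
      intro m hd
      refine (h.idealSpan_sqSet_le hσ hs hgen m).trans (sup_le ?_ (iSup₂_le fun m' hm => ?_))
      · exact Submodule.span_mono (Set.subset_iUnion (fun m => sqSet U σ n m (s m)) m)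
      · refine ih _ ?_ m' rfl
        rw [Int.abs_eq_natAbs, Int.abs_eq_natAbs] at hm
        split_ifs at hd ⊢ <;> omega
  refine top_le_iff.1 fun y _ => ?_
  obtain ⟨p⟩ := exists_walk_neg n
  obtain ⟨q, hq⟩ := h.exists_elt_eq_wordEplus p le_rfl
  have h1 : (1 : A) ∈ sqSet U σ n (-n) (s (-n)) := by
    have := h.elt_mem_sqSet hσ (hs _) q
    rwa [hq, h.evalWord_wordEplus (k := 0) (by omega), if_neg (by omega)] at this
  have h2 := mul_mem_idealSpan_left (R := R) y (subset_idealSpan (R := R) h1)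
  rw [mul_one] at h2
  exact key _ _ rfl h2

end IsBlobFamily

end Spanning

/-! ### The generators of b_n form such a family -/

section BlobAlgebra

variable (K : Type*) [CommRing K] (x : Kˣ) (γ δ : K) (n : ℕ) (k : Type*) [CommRing k] [Algebra K k]

variable {K x γ δ n k} in
theorem gen_of_lt {i : ℕ} (hi : i < n) :
    gen K x γ δ n k i = 1 ⊗ₜ[K] genK K x γ δ n ⟨i, hi⟩ := dif_pos hi

variable {K x γ δ n k} in
theorem gen_of_le {i : ℕ} (hi : n ≤ i) : gen K x γ δ n k i = 0 := dif_neg hi.not_gt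

theorem isBlobFamily_gen :
    IsBlobFamily (gen K x γ δ n k) n
      (algebraMap K k (((x ^ 2 : Kˣ) : K) + (((x ^ 2)⁻¹ : Kˣ) : K))) (algebraMap K k γ)
      (algebraMap K k δ) := by
  have key : ∀ {a b}, Rel K x γ δ n a b → RingQuot.mkAlgHom K (Rel K x γ δ n) a =
      RingQuot.mkAlgHom K (Rel K x γ δ n) b := fun {a b} h => RingQuot.mkAlgHom_rel K h
  constructor
  · intro i
    rcases lt_or_ge (i + 1) n with hi | hi
    · have := key (.U_sq ⟨i + 1, hi⟩ (Nat.succ_pos i))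
      simp only [map_mul, map_smul] at this
      rw [gen_of_lt hi, Algebra.TensorProduct.tmul_mul_tmul, one_mul, genK, this,
        algebraMap_smul, TensorProduct.tmul_smul]
    · simp [gen_of_le hi]
  · intro i hi
    have := key (.U_adjacent ⟨i + 1, by omega⟩ ⟨i + 2, hi⟩ (Nat.succ_pos i) (Nat.succ_pos _)
      (Or.inl rfl))
    simp only [map_mul] at this
    rw [gen_of_lt hi, gen_of_lt (by omega : i + 1 < n),
      Algebra.TensorProduct.tmul_mul_tmul, Algebra.TensorProduct.tmul_mul_tmul, one_mul, one_mul,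
      genK, genK, this]
  · intro i
    rcases lt_or_ge (i + 2) n with hi | hi
    · have := key (.U_adjacent ⟨i + 2, hi⟩ ⟨i + 1, by omega⟩ (Nat.succ_pos _) (Nat.succ_pos _)
        (Or.inr rfl))
      simp only [map_mul] at this
      rw [gen_of_lt hi, gen_of_lt (by omega : i + 1 < n),
        Algebra.TensorProduct.tmul_mul_tmul, Algebra.TensorProduct.tmul_mul_tmul, one_mul, one_mul,
        genK, genK, this]
    · simp [gen_of_le hi]
  · intro i j hij
    rcases lt_or_ge j n with hj | hj
    · rcases Nat.eq_zero_or_pos i with rfl | hi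
      · have := key (.e_comm ⟨j, hj⟩ ⟨0, by omega⟩ (by simpa using hij) rfl)
        simp only [map_mul] at this
        rw [gen_of_lt hj, gen_of_lt (by omega : 0 < n), commute_iff_eq,
          Algebra.TensorProduct.tmul_mul_tmul, Algebra.TensorProduct.tmul_mul_tmul, genK, genK,
          this]
      · have := key (.U_comm ⟨i, by omega⟩ ⟨j, hj⟩ hi (by simp; omega) (by simp; omega))
        simp only [map_mul] at this
        rw [gen_of_lt hj, gen_of_lt (by omega : i < n), commute_iff_eq,
          Algebra.TensorProduct.tmul_mul_tmul, Algebra.TensorProduct.tmul_mul_tmul, genK, genK,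
          this]
    · rw [gen_of_le hj]
      exact Commute.zero_right _
  · rcases lt_or_ge 1 n with hi | hi
    · have := key (.U_e_U ⟨1, hi⟩ ⟨0, by omega⟩ rfl rfl)
      simp only [map_mul, map_smul] at this
      rw [gen_of_lt hi, gen_of_lt (by omega : 0 < n),
        Algebra.TensorProduct.tmul_mul_tmul, Algebra.TensorProduct.tmul_mul_tmul, one_mul, one_mul,
        genK, genK, this, algebraMap_smul, TensorProduct.tmul_smul]
    · simp [gen_of_le hi]
  · rcases lt_or_ge 0 n with hi | hi
    · have := key (.e_sq ⟨0, hi⟩ rfl)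
      simp only [map_mul, map_smul] at this
      rw [gen_of_lt hi, Algebra.TensorProduct.tmul_mul_tmul, one_mul, genK, this,
        algebraMap_smul, TensorProduct.tmul_smul]
    · simp [gen_of_le hi]

/-- The opposite isomorphism as a linear map. -/
def oppositeLinear : Alg K x γ δ n k →ₗ[k] Alg K x γ δ n k :=
  (MulOpposite.opLinearEquiv k).symm.toLinearMap ∘ₗ (opp K x γ δ n k).toLinearMap

theorem oppositeLinear_apply (a : Alg K x γ δ n k) :
    oppositeLinear K x γ δ n k a = opposite K x γ δ n k a := rfl

theorem isReversal_oppositeLinear :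
    IsReversal (gen K x γ δ n k) (oppositeLinear K x γ δ n k) where
  map_one := by simp [oppositeLinear_apply, opposite]
  map_mul a b := by simp [oppositeLinear_apply, opposite]
  map_U i := by simp [oppositeLinear_apply, opposite, opp_gen]

theorem eq_top_of_gen_mem (S : Subalgebra k (Alg K x γ δ n k))
    (hS : ∀ i < n, gen K x γ δ n k i ∈ S) : S = ⊤ := by
  let f : FreeAlgebra K (Fin n) →ₐ[K] Alg K x γ δ n k :=
    (Algebra.TensorProduct.includeRight : AlgK K x γ δ n →ₐ[K] Alg K x γ δ n k).comp
      (RingQuot.mkAlgHom K (Rel K x γ δ n))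
  have h1 : ∀ a, f a ∈ S := by
    intro a
    induction a using FreeAlgebra.induction with
    | grade0 c =>
      rw [AlgHom.commutes, IsScalarTower.algebraMap_apply K k]
      exact S.algebraMap_mem _
    | grade1 i =>
      have := hS i i.isLt
      rwa [gen_of_lt i.isLt] at this
    | mul a b ha hb => rw [map_mul]; exact S.mul_mem ha hb
    | add a b ha hb => rw [map_add]; exact S.add_mem ha hb
  refine top_le_iff.1 fun y _ => ?_
  induction y using TensorProduct.induction_on with
  | zero => exact S.zero_mem
  | tmul c b =>
    obtain ⟨a, rfl⟩ := RingQuot.mkAlgHom_surjective K (Rel K x γ δ n) b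
    have : c • f a ∈ S := S.smul_mem (h1 a) c
    rwa [show c • f a = c ⊗ₜ[K] RingQuot.mkAlgHom K (Rel K x γ δ n) a by
      simp [f, TensorProduct.smul_tmul']] at this
  | add a b ha hb => exact S.add_mem (ha trivial) (hb trivial)

end BlobAlgebra

end Blob

end

theorem mainTheorem4 (K : Type*) [CommRing K] (x : Kˣ) (γ δ : K)
    (k : Type*) [CommRing k] [Algebra K k] (n : ℕ) :
    (∃ s : ℤ → Set Blob.Word, ∀ m : ℤ, Blob.IsCoefficientSet K x γ δ n k m (s m)) ∧
    ∀ s : ℤ → Set Blob.Word, (∀ m : ℤ, Blob.IsCoefficientSet K x γ δ n k m (s m)) →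
      (∀ m : ℤ,
        Blob.idealSpan k (Blob.setSsq K x γ δ n k m (s m)) ⊔
            ⨆ m' : ℤ, ⨆ _ : |m'| < |m| ∨ (m < 0 ∧ m' = -m),
              Blob.idealSpan k (Blob.setSsq K x γ δ n k m' (s m')) =
          Submodule.span k (Blob.setSsq K x γ δ n k m (s m)) ⊔
            ⨆ m' : ℤ, ⨆ _ : |m'| < |m| ∨ (m < 0 ∧ m' = -m),
              Blob.idealSpan k (Blob.setSsq K x γ δ n k m' (s m'))) ∧
      Submodule.span k (⋃ m : ℤ, Blob.setSsq K x γ δ n k m (s m)) = ⊤ := by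
  have h := Blob.isBlobFamily_gen K x γ δ n k
  have hσ := Blob.isReversal_oppositeLinear K x γ δ n k
  have hgen := Blob.eq_top_of_gen_mem K x γ δ n k
  constructor
  · choose s hs using h.exists_isCoeff
    exact ⟨s, hs⟩
  · intro s hs
    have hs' : ∀ m, Blob.IsCoeff (Blob.gen K x γ δ n k) n m (s m) := fun m => (hs m).2
    exact ⟨h.idealSpan_sqSet_sup_lowerIdeal hσ hs' hgen, h.span_iUnion_sqSet hσ hs' hgen⟩
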